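/- Let $m\ge 1$, let $0<b_0<b_1<\cdots<b_m$ be integers and let $e_0,\dots,e_m$ be positive integers. Put $M=\{(b_0,e_0),\dots,(b_m,e_m)\}$. For a set $\mathcal A$ of non-negative integers and an integer $n\ge 0$, let $r_M(n,\mathcal A)$ be the number of families $(a_{i,j})_{0\le i\le m,\,1\le j\le e_i}$ of elements of $\mathcal A$ such that $$n=b_0(a_{0,1}+\cdots+a_{0,e_0})+b_1(a_{1,1}+\cdots+a_{1,e_1})+\cdots+b_m(a_{m,1}+\cdots+a_{m,e_m}).$$ Suppose that there are a prime $p$ and an integer $t>0$ such that $p^t\mid b_0$ but $p^t\nmid b_i$ for all $1\le i\le m$. Then for every infinite set $\mathcal A$ of non-negative integers (in particular, for every infinite set of positive integers), $r_M(n,\mathcal A)$ is not constant for $n$ large enough; that is, there are no integers $c$ and $n_0$ with $r_M(n,\mathcal A)=c$ for all $n\ge n_0$. -/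

import Mathlib

/-- The solutions of `n = ∑ i, b i * (a i 0 + ⋯ + a i (e i - 1))` in elements `a i j` of `A`. -/
def repSet {m : ℕ} (b e : Fin (m + 1) → ℕ) (A : Set ℕ) (n : ℕ) :
    Set ((i : Fin (m + 1)) → Fin (e i) → ℕ) :=
  {a | (∀ i j, a i j ∈ A) ∧ n = ∑ i, b i * ∑ j, a i j}

/-- If all coefficients are positive, there are only finitely many solutions, so counting them
with `Set.ncard` is meaningful. -/
theorem repSet_finite {m : ℕ} (b e : Fin (m + 1) → ℕ) (hb : ∀ i, 0 < b i) (A : Set ℕ) (n : ℕ) :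
    (repSet b e A n).Finite := by
  refine (Set.finite_Iic (fun (i : Fin (m + 1)) (_ : Fin (e i)) => n)).subset ?_
  rintro a ⟨-, ha⟩ i j
  calc a i j ≤ ∑ j, a i j := Finset.single_le_sum (fun _ _ => Nat.zero_le _) (Finset.mem_univ j)
    _ ≤ b i * ∑ j, a i j := Nat.le_mul_of_pos_left _ (hb i)
    _ ≤ ∑ i, b i * ∑ j, a i j :=
        Finset.single_le_sum (f := fun i => b i * ∑ j, a i j)
          (fun _ _ => Nat.zero_le _) (Finset.mem_univ i)
    _ = n := ha.symm

/-- The representation function `r_M(n, A)` for `M = {(b 0, e 0), …, (b m, e m)}`: the number of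
solutions of `n = ∑ i, b i * (a i 0 + ⋯ + a i (e i - 1))` with all `a i j ∈ A`. -/
noncomputable def repFun {m : ℕ} (b e : Fin (m + 1) → ℕ) (A : Set ℕ) (n : ℕ) : ℕ :=
  (repSet b e A n).ncard

/-!
Suppose that `repFun b e A n = c` for all large `n`. With `G(z) = ∑ z ^ a` over `a ∈ A`, the product
`∏ G(z ^ b i) ^ e i` is then `Q(z) / (z - 1)` for a polynomial `Q` with rational coefficients and
`Q(1) = -c`, and `c ≠ 0` because `A` is infinite. The logarithmic derivatives `z G' / G` and
`z Q' / Q` turn this into a linear relation. If `a n` are the coefficients of the former, then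
`∑ i, e i * b i * a (n / b i)`, over those `i` with `b i ∣ n`, equals
`∑ k ∣ n, k * D k - ∑ ρ ^ n` for `n ≥ 1`. Here `D` is a finitely supported integer function of sum
`1`, which records the cyclotomic factors of `Q` and the pole at `1`
(`exists_coeff_logDeriv_cyclotomic`), and `ρ` runs over the inverses of the nonzero roots of `Q`
that are not roots of unity (`hasLogFactorization_map`).

The `ρ` are removed by linear algebra. There is a `ℚ`-linear functional on complex sequences that
is `1` on the constant sequence `1` and `0` on `y ↦ β ^ y` for every `β ≠ 1` (`exists_mean`). It is
applied along the progressions `n * (1 + K * y)`, where `K` is divisible by all `b i` and by the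
support of `D` (`exists_dilation_sum_eq`). Möbius inversion then gives a rational function `α`
with `∑ i, e i * α (l / b i) = D l` for all `l ≥ 1` (`exists_dilation_solution`). In terms of
Dirichlet series, `α` is the quotient of the Dirichlet polynomial `D` by `∑ e i * (b i) ^ (-s)`.

This is impossible (`no_dilation_solution`). Solving for the term `i = 0` at `l = b 0 * d`
expresses `α d` by `D` and by values of `α` at `b 0 * d / b i` with `i ≠ 0`. These arguments are
smaller than `d`, as `b 0` is the least of the `b i`, and divisible by a higher power of `p`.
Hence `α` is finitely supported (`exists_forall_lt_eq_zero`). By Gauss's lemma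
(`prime_dvd_of_dvd_sum`) the function `g * α` is integral, where `g` is the greatest common divisor
of the `e i`. Summing over all `l` yields `1 = (∑ e i / g) * ∑ g * α d`, a product of integers whose
first factor is at least `m + 1 ≥ 2`.
-/

open Finset Filter

/-! ### Dirichlet products with finitely many dilations -/

theorem sum_Ioc_dvd {R : Type*} [AddCommMonoid R] (f : ℕ → R) {b : ℕ} (hb : 0 < b) (T : ℕ) :
    ∑ l ∈ Ioc 0 T, (if b ∣ l then f (l / b) else 0) = ∑ x ∈ Ioc 0 (T / b), f x := by
  rw [← sum_filter]
  refine sum_nbij' (fun l => l / b) (fun x => b * x) ?_ ?_ ?_ ?_ ?_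
  · intro l hl
    simp only [mem_filter, mem_Ioc] at hl ⊢
    exact ⟨Nat.div_pos (Nat.le_of_dvd hl.1.1 hl.2) hb, Nat.div_le_div_right hl.1.2⟩
  · intro x hx
    simp only [mem_filter, mem_Ioc] at hx ⊢
    refine ⟨⟨Nat.mul_pos hb hx.1, ?_⟩, dvd_mul_right _ _⟩
    rw [mul_comm]
    exact (Nat.le_div_iff_mul_le hb).1 hx.2
  · intro l hl
    simp only [mem_filter] at hl
    exact Nat.mul_div_cancel' hl.2
  · intro x _
    exact Nat.mul_div_cancel_left x hb
  · intro l _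
    rfl

/-- If the sums stabilise at `c`, then the summand vanishes eventually. -/
theorem exists_forall_lt_of_eventually_sum {D : ℕ → ℤ} {c : ℤ}
    (hD : ∀ᶠ T in atTop, ∑ l ∈ Ioc 0 T, D l = c) : ∃ S, ∀ l, S < l → D l = 0 := by
  obtain ⟨S, hS⟩ := eventually_atTop.1 hD
  refine ⟨S, fun l hl => ?_⟩
  obtain ⟨k, rfl⟩ : ∃ k, l = k + 1 := ⟨l - 1, by omega⟩
  have h1 := hS (k + 1) (by omega)
  have h2 := hS k (by omega)
  rw [sum_Ioc_succ_top (by omega), h2] at h1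
  linarith

theorem eq_zero_of_forall_ne_zero {m : ℕ} {b e : Fin (m + 1) → ℕ} (hb0 : 0 < b 0)
    (he : 0 < e 0) {D : ℕ → ℤ} {α : ℕ → ℚ}
    (hα : ∀ l, l ≠ 0 → ∑ i, (if b i ∣ l then (e i : ℚ) * α (l / b i) else 0) = D l)
    {d : ℕ} (hd : d ≠ 0) (hD : D (b 0 * d) = 0)
    (h : ∀ i, i ≠ 0 → ∀ x, b i * x = b 0 * d → α x = 0) : α d = 0 := by
  have := hα (b 0 * d) (Nat.mul_ne_zero hb0.ne' hd)
  rw [sum_eq_single_of_mem 0 (mem_univ _), if_pos (dvd_mul_right _ _),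
    Nat.mul_div_cancel_left _ hb0, hD] at this
  · have he' : (e 0 : ℚ) ≠ 0 := by exact_mod_cast he.ne'
    simpa [he'] using this
  · intro i _ hi
    split_ifs with hdvd
    · rw [h i hi _ (Nat.mul_div_cancel' hdvd), mul_zero]
    · rfl

/-- Comparing coefficients at `b 0 * d` expresses `α d` through values `α x` with
`b i * x = b 0 * d`. Such an `x` is smaller than `d`, since `b 0` is the least of the `b i`, and
it is divisible by a higher power of `p`. For `d` divisible by a high power of `p` the values of `D`
vanish, so that `α d = 0` by descent on `d`. Every other `d` is led to these in boundedly many steps,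
each of which divides it by a bounded factor, so `α d = 0` if `d` is large. -/
theorem exists_forall_lt_eq_zero {m : ℕ} {b e : Fin (m + 1) → ℕ} (hb0 : 0 < b 0)
    (hb : StrictMono b) (he : 0 < e 0) {p t : ℕ} (hp : p.Prime) (hpt : p ^ t ∣ b 0)
    (hpt' : ∀ i, i ≠ 0 → ¬ p ^ t ∣ b i) {D : ℕ → ℤ} {S : ℕ} (hS : ∀ l, S < l → D l = 0)
    {α : ℕ → ℚ}
    (hα : ∀ l, l ≠ 0 → ∑ i, (if b i ∣ l then (e i : ℚ) * α (l / b i) else 0) = D l) :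
    ∃ N, ∀ d, N < d → α d = 0 := by
  have hlt : ∀ i, i ≠ 0 → b 0 < b i := fun i hi => hb (Fin.pos_iff_ne_zero.2 hi)
  -- passing from `d` to `x` gains a factor `p`
  have hgain : ∀ i, i ≠ 0 → ∀ d x k, b i * x = b 0 * d → p ^ k ∣ d → p ^ (k + 1) ∣ x := by
    intro i hi d x k hx hk
    have hpos : 0 < b i := hb0.trans (hlt i hi)
    have h1 : p ^ (t + k) ∣ b i * x := by
      rw [hx, pow_add]
      exact mul_dvd_mul hpt hk
    by_cases hx0 : x = 0
    · simp [hx0]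
    have hbi := hpos.ne'
    rw [hp.pow_dvd_iff_le_factorization (Nat.mul_ne_zero hbi hx0),
      Nat.factorization_mul hbi hx0, Finsupp.add_apply] at h1
    have h2 := hpt' i hi
    rw [hp.pow_dvd_iff_le_factorization hbi] at h2
    rw [hp.pow_dvd_iff_le_factorization hx0]
    omega
  have hhigh : ∀ d, d ≠ 0 → p ^ S ∣ d → α d = 0 := by
    intro d
    induction d using Nat.strong_induction_on with
    | _ d ih =>
      intro hd hpd
      have hSd : S < d := (Nat.lt_pow_self hp.one_lt).trans_le
        (Nat.le_of_dvd (Nat.pos_of_ne_zero hd) hpd)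
      refine eq_zero_of_forall_ne_zero hb0 he hα hd
        (hS _ (hSd.trans_le (Nat.le_mul_of_pos_left d hb0))) fun i hi x hx => ?_
      have hx0 : x ≠ 0 := by
        rintro rfl
        exact Nat.mul_ne_zero hb0.ne' hd (by simpa using hx.symm)
      refine ih x ?_ hx0 ((pow_dvd_pow p (Nat.le_succ S)).trans (hgain i hi d x S hx hpd))
      by_contra hle
      have := Nat.mul_lt_mul_of_lt_of_le (hlt i hi) (not_lt.1 hle) (Nat.pos_of_ne_zero hx0)
      omega
  have hstep : ∀ j ≤ S, ∃ N, ∀ d, N < d → p ^ (S - j) ∣ d → α d = 0 := by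
    intro j
    induction j with
    | zero => exact fun _ => ⟨0, fun d hd h => hhigh d hd.ne' h⟩
    | succ j ih =>
      intro hj
      obtain ⟨N, hN⟩ := ih (by omega)
      refine ⟨max S (N * b (Fin.last m)), fun d hd hpd => ?_⟩
      have hSd : S < d := (le_max_left _ _).trans_lt hd
      have hNd : N * b (Fin.last m) < d := (le_max_right _ _).trans_lt hd
      refine eq_zero_of_forall_ne_zero hb0 he hα (by omega)
        (hS _ (hSd.trans_le (Nat.le_mul_of_pos_left d hb0))) fun i hi x hx => hN x ?_ ?_
      · by_contra hle
        have h1 : b i * x ≤ b (Fin.last m) * N :=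
          Nat.mul_le_mul (hb.monotone (Fin.le_last i)) (not_lt.1 hle)
        have h2 : d ≤ b 0 * d := Nat.le_mul_of_pos_left d hb0
        rw [mul_comm] at hNd
        omega
      · have := hgain i hi d x _ hx hpd
        rwa [show S - (j + 1) + 1 = S - j by omega] at this
  obtain ⟨N, hN⟩ := hstep S le_rfl
  exact ⟨N, fun d hd => hN d hd (by simp)⟩

/-- Gauss's lemma for the Dirichlet product with `∑ e i * (b i) ^ (-s)`. -/
theorem prime_dvd_of_dvd_sum {m : ℕ} {b e : Fin (m + 1) → ℕ} (hb0 : 0 < b 0)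
    (hb : StrictMono b) {q : ℕ} (hq : q.Prime) (hqe : ∃ i, ¬ q ∣ e i) {β : ℕ → ℤ}
    (hβ : ∀ l, l ≠ 0 → (q : ℤ) ∣ ∑ i, (if b i ∣ l then (e i : ℤ) * β (l / b i) else 0)) :
    ∀ d, d ≠ 0 → (q : ℤ) ∣ β d := by
  have hpos : ∀ i, 0 < b i := fun i => hb0.trans_le (hb.monotone (Fin.zero_le i))
  obtain ⟨i, hi, himin⟩ := WellFounded.has_min (wellFounded_lt (α := Fin (m + 1)))
    {i | ¬ q ∣ e i} hqe
  intro d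
  induction d using Nat.strong_induction_on with
  | _ d ih =>
    intro hd
    have h := hβ (b i * d) (Nat.mul_ne_zero (hpos i).ne' hd)
    rw [← add_sum_erase _ _ (mem_univ i), if_pos (dvd_mul_right _ _),
      Nat.mul_div_cancel_left _ (hpos i)] at h
    have h' : (q : ℤ) ∣ ∑ j ∈ univ.erase i,
        (if b j ∣ b i * d then (e j : ℤ) * β (b i * d / b j) else 0) := by
      refine dvd_sum fun j hj => ?_
      split_ifs with hdvd
      · rcases lt_or_gt_of_ne (ne_of_mem_erase hj) with hji | hij
        · exact (Int.natCast_dvd_natCast.2 (not_not.1 fun hc => himin j hc hji)).mul_right _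
        · obtain ⟨x, hx⟩ := hdvd
          have hx0 : x ≠ 0 := by
            rintro rfl
            exact Nat.mul_ne_zero (hpos i).ne' hd (by simpa using hx)
          rw [hx, Nat.mul_div_cancel_left _ (hpos j)]
          refine (ih x ?_ hx0).mul_left _
          by_contra hle
          have := Nat.mul_lt_mul_of_lt_of_le (hb hij) (not_lt.1 hle) (Nat.pos_of_ne_zero hx0)
          omega
      · exact dvd_zero _
    have h2 := (dvd_add_left h').1 h
    rcases (Nat.prime_iff_prime_int.1 hq).dvd_or_dvd h2 with h3 | h3
    · exact absurd (Int.natCast_dvd_natCast.1 h3) hi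
    · exact h3

/-- If the weights `e i` have no common factor, then a rational solution with common denominator
`L` is integral. -/
theorem exists_int_solution {m : ℕ} {b e : Fin (m + 1) → ℕ} (hb0 : 0 < b 0)
    (hb : StrictMono b) (hgcd : ∀ q : ℕ, q.Prime → ∃ i, ¬ q ∣ e i) {D : ℕ → ℤ} (L : ℕ)
    (hL : L ≠ 0) {β : ℕ → ℤ}
    (hβ : ∀ l, l ≠ 0 → ∑ i, (if b i ∣ l then (e i : ℤ) * β (l / b i) else 0) = L * D l) :
    ∃ γ : ℕ → ℤ, (∀ d, d ≠ 0 → β d = L * γ d) ∧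
      ∀ l, l ≠ 0 → ∑ i, (if b i ∣ l then (e i : ℤ) * γ (l / b i) else 0) = D l := by
  induction L using Nat.strong_induction_on generalizing β with
  | _ L ih =>
    by_cases hL1 : L = 1
    · exact ⟨β, fun d _ => by simp [hL1], fun l hl => by simpa [hL1] using hβ l hl⟩
    have hq := Nat.minFac_prime hL1
    set q := L.minFac with hqdef
    obtain ⟨L', hL'⟩ : q ∣ L := Nat.minFac_dvd L
    have hq0 : (q : ℤ) ≠ 0 := by exact_mod_cast hq.ne_zero
    have hL'0 : L' ≠ 0 := by
      rintro rfl
      exact hL (by simpa using hL')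
    have hdvd := prime_dvd_of_dvd_sum hb0 hb hq (hgcd q hq) (β := β) fun l hl => by
      rw [hβ l hl, hL']
      push_cast
      exact (dvd_mul_right _ _).mul_right _
    have hβ' : ∀ d, d ≠ 0 → β d = q * (β d / q) := fun d hd =>
      (Int.mul_ediv_cancel' (hdvd d hd)).symm
    obtain ⟨γ, hγ, hγ'⟩ := ih L'
      (by
        rw [hL']
        exact lt_mul_of_one_lt_left (Nat.pos_of_ne_zero hL'0) hq.one_lt)
      hL'0 (β := fun d => β d / q) fun l hl => by
        apply mul_left_cancel₀ hq0
        have := hβ l hl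
        rw [hL'] at this
        push_cast at this
        rw [← mul_assoc, ← this, mul_sum]
        refine sum_congr rfl fun i _ => ?_
        split_ifs with h
        · have : l / b i ≠ 0 := by
            have hpos : 0 < b i := hb0.trans_le (hb.monotone (Fin.zero_le i))
            exact (Nat.div_pos (Nat.le_of_dvd (Nat.pos_of_ne_zero hl) h) hpos).ne'
          conv_rhs => rw [hβ' _ this]
          ring
        · simp
    refine ⟨γ, fun d hd => ?_, hγ'⟩
    rw [hβ' d hd, hγ d hd, hL']
    push_cast
    ring

theorem sum_dilation_eq {m : ℕ} {b e : Fin (m + 1) → ℕ} (hpos : ∀ i, 0 < b i) {γ : ℕ → ℤ} {N : ℕ}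
    (hN : ∀ d, N < d → γ d = 0) {T : ℕ} (hT : ∀ i, b i * N ≤ T) :
    ∑ l ∈ Ioc 0 T, ∑ i, (if b i ∣ l then (e i : ℤ) * γ (l / b i) else 0) =
      (∑ i, (e i : ℤ)) * ∑ d ∈ Ioc 0 N, γ d := by
  rw [sum_comm, sum_mul]
  refine sum_congr rfl fun i _ => ?_
  rw [sum_Ioc_dvd (fun x => (e i : ℤ) * γ x) (hpos i), mul_sum]
  symm
  refine sum_subset (Ioc_subset_Ioc_right ?_) fun x _ hx => ?_
  · rw [Nat.le_div_iff_mul_le (hpos i), mul_comm]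
    exact hT i
  · simp only [mem_Ioc, not_and, not_le] at hx
    by_cases hx0 : 0 < x
    · rw [hN x (hx hx0), mul_zero]
    · simp_all

/-- In terms of Dirichlet series: a Dirichlet polynomial with integer coefficients of sum `1` is
not a multiple of `∑ e i * (b i) ^ (-s)`. -/
theorem no_dilation_solution {m : ℕ} (hm : 1 ≤ m) {b e : Fin (m + 1) → ℕ} (hb0 : 0 < b 0)
    (hb : StrictMono b) (he : ∀ i, 0 < e i) {p t : ℕ} (hp : p.Prime) (hpt : p ^ t ∣ b 0)
    (hpt' : ∀ i, i ≠ 0 → ¬ p ^ t ∣ b i) {D : ℕ → ℤ}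
    (hD : ∀ᶠ T in atTop, ∑ l ∈ Ioc 0 T, D l = 1) {α : ℕ → ℚ}
    (hα : ∀ l, l ≠ 0 → ∑ i, (if b i ∣ l then (e i : ℚ) * α (l / b i) else 0) = D l) :
    False := by
  have hpos : ∀ i, 0 < b i := fun i => hb0.trans_le (hb.monotone (Fin.zero_le i))
  obtain ⟨S, hS⟩ := exists_forall_lt_of_eventually_sum hD
  obtain ⟨N, hN⟩ := exists_forall_lt_eq_zero hb0 hb (he 0) hp hpt hpt' hS hα
  -- divide the weights by their greatest common divisor
  set g := univ.gcd e with hg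
  obtain ⟨e', he', hgcd⟩ := extract_gcd e (univ_nonempty (α := Fin (m + 1)))
  have hg0 : 0 < g := Nat.pos_of_ne_zero fun h =>
    (he 0).ne' (gcd_eq_zero_iff.1 h 0 (mem_univ _))
  have he'pos : ∀ i, 0 < e' i := fun i => Nat.pos_of_ne_zero fun h => by
    have := he' i (mem_univ _)
    rw [h, mul_zero] at this
    exact (he i).ne' this
  -- a common denominator of the values of `g * α`
  obtain ⟨L, hL, β, hβ⟩ : ∃ L : ℕ, L ≠ 0 ∧ ∃ β : ℕ → ℤ, ∀ d, (β d : ℚ) = L * (g * α d) := by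
    refine ⟨∏ d ∈ range (N + 1), (g * α d).den,
      prod_ne_zero_iff.2 fun d _ => Rat.den_ne_zero _, ?_⟩
    have : ∀ d, ∃ z : ℤ, (z : ℚ) = (∏ d ∈ range (N + 1), (g * α d).den : ℕ) * (g * α d) := by
      intro d
      by_cases hd : N < d
      · exact ⟨0, by simp [hN d hd]⟩
      obtain ⟨k, hk⟩ := dvd_prod_of_mem (fun d => (g * α d).den) (mem_range.2 (by omega : d < N + 1))
      refine ⟨k * (g * α d).num, ?_⟩
      rw [hk]
      push_cast
      have := Rat.mul_den_eq_num (g * α d)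
      rw [← this]
      ring
    choose β hβ using this
    exact ⟨β, hβ⟩
  obtain ⟨γ, hγ, hγD⟩ := exists_int_solution (b := b) (e := e') hb0 hb
    (fun q hq => by
      by_contra! hall
      have := dvd_gcd (s := univ) (f := e') (a := q) fun i _ => hall i
      rw [hgcd] at this
      exact hq.one_lt.ne' (Nat.dvd_one.1 this))
    L hL (β := β) (D := D) fun l hl => by
      have : ((∑ i, (if b i ∣ l then (e' i : ℤ) * β (l / b i) else 0) : ℤ) : ℚ) =
          ((L * D l : ℤ) : ℚ) := by
        push_cast
        rw [← hα l hl, mul_sum]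
        refine sum_congr rfl fun i _ => ?_
        split_ifs
        · rw [hβ, he' i (mem_univ _)]
          push_cast
          ring
        · simp
      exact_mod_cast this
  have hγN : ∀ d, N < d → γ d = 0 := by
    intro d hd
    have h0 : (β d : ℚ) = 0 := by rw [hβ, hN d hd]; simp
    have h1 := hγ d (by omega)
    rw [Int.cast_eq_zero.1 h0] at h1
    simpa [hL] using h1.symm
  obtain ⟨T, hT, hTN⟩ := (hD.and (eventually_ge_atTop (b (Fin.last m) * N))).exists
  have hsum := sum_dilation_eq (e := e') hpos hγN (T := T) fun i =>
    (Nat.mul_le_mul_right N (hb.monotone (Fin.le_last i))).trans hTN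
  rw [sum_congr rfl fun l hl => hγD l (by simp only [mem_Ioc] at hl; omega), hT] at hsum
  have h1 : (∑ i, (e' i : ℤ)) = 1 ∨ (∑ i, (e' i : ℤ)) = -1 :=
    Int.isUnit_iff.1 (IsUnit.of_mul_eq_one _ hsum.symm)
  have h2 : ((m + 1 : ℕ) : ℤ) ≤ ∑ i, (e' i : ℤ) := by
    have := card_nsmul_le_sum (univ : Finset (Fin (m + 1))) (fun i => (e' i : ℤ)) 1
      fun i _ => by exact_mod_cast he'pos i
    simpa using this
  push_cast at h2
  omega

/-! ### Logarithmic derivatives of power series and polynomials -/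

open PowerSeries in
/-- `H` is the logarithmic derivative `z G' / G` of the power series `G`. Written without division,
this also makes sense if `G` has vanishing constant coefficient. -/
def IsLogDeriv (G H : PowerSeries ℂ) : Prop :=
  X * derivative ℂ G = G * H

namespace IsLogDeriv

open PowerSeries

variable {G₁ G₂ H₁ H₂ : PowerSeries ℂ}

theorem one : IsLogDeriv 1 0 := by simp [IsLogDeriv]

theorem mul (h₁ : IsLogDeriv G₁ H₁) (h₂ : IsLogDeriv G₂ H₂) :
    IsLogDeriv (G₁ * G₂) (H₁ + H₂) := by
  unfold IsLogDeriv at *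
  rw [Derivation.leibniz, smul_eq_mul, smul_eq_mul]
  linear_combination G₂ * h₁ + G₁ * h₂

theorem pow (h : IsLogDeriv G₁ H₁) (e : ℕ) : IsLogDeriv (G₁ ^ e) (e • H₁) := by
  induction e with
  | zero => simpa using one
  | succ e ih =>
    rw [pow_succ, succ_nsmul]
    exact ih.mul h

theorem prod {ι : Type*} (s : Finset ι) {G H : ι → PowerSeries ℂ}
    (h : ∀ i ∈ s, IsLogDeriv (G i) (H i)) : IsLogDeriv (∏ i ∈ s, G i) (∑ i ∈ s, H i) := by
  classical
  induction s using Finset.induction_on with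
  | empty => simpa using one
  | insert i s hi ih =>
    rw [prod_insert hi, sum_insert hi]
    exact (h i (mem_insert_self i s)).mul (ih fun j hj => h j (mem_insert_of_mem hj))

theorem coeff_X_mul_derivative (G : PowerSeries ℂ) (n : ℕ) :
    coeff n (X * derivative ℂ G) = n * coeff n G := by
  cases n with
  | zero => simp
  | succ n =>
    rw [coeff_succ_X_mul, coeff_derivative]
    push_cast
    ring

theorem expand (h : IsLogDeriv G₁ H₁) {b : ℕ} (hb : b ≠ 0) :
    IsLogDeriv (G₁.expand b hb) (b • H₁.expand b hb) := by
  unfold IsLogDeriv at *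
  have : X * derivative ℂ (G₁.expand b hb) =
      (b : PowerSeries ℂ) * (X * derivative ℂ G₁).expand b hb := by
    ext n
    rw [coeff_X_mul_derivative, ← nsmul_eq_mul (b : ℕ) (PowerSeries.expand b hb _), map_nsmul,
      coeff_expand, coeff_expand]
    split_ifs with hn
    · obtain ⟨k, rfl⟩ := hn
      rw [Nat.mul_div_cancel_left _ (Nat.pos_of_ne_zero hb), coeff_X_mul_derivative, nsmul_eq_mul]
      push_cast
      ring
    · simp
  rw [this, h, map_mul, nsmul_eq_mul]
  ring

theorem unique (hG : G₁ ≠ 0) (h₁ : IsLogDeriv G₁ H₁) (h₂ : IsLogDeriv G₁ H₂) : H₁ = H₂ :=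
  mul_left_cancel₀ hG (h₁.symm.trans h₂)

theorem X_self : IsLogDeriv (X : PowerSeries ℂ) 1 := by simp [IsLogDeriv]

theorem exists_of_ne_zero {G : PowerSeries ℂ} (hG : G ≠ 0) : ∃ H, IsLogDeriv G H := by
  have hunit : IsUnit G.divXPowOrder := by
    rw [isUnit_iff_constantCoeff, isUnit_iff_ne_zero]
    exact constantCoeff_divXPowOrder_eq_zero_iff.not.2 hG
  obtain ⟨U, hU⟩ := hunit
  have hU' : IsLogDeriv (U : PowerSeries ℂ)
      ((↑U⁻¹ : PowerSeries ℂ) * (X * derivative ℂ (U : PowerSeries ℂ))) := by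
    simp [IsLogDeriv]
  have h := (X_self.pow G.order.toNat).mul hU'
  rw [hU, X_pow_order_mul_divXPowOrder] at h
  exact ⟨_, h⟩

theorem const (c : ℂ) : IsLogDeriv (C c) 0 := by simp [IsLogDeriv]

/-- The logarithmic derivative of `z - a` is `-∑ a⁻ⁿ zⁿ`, the sum starting at `n = 1`. -/
theorem X_sub_const {a : ℂ} (ha : a ≠ 0) :
    IsLogDeriv (X - C a) (mk fun n => if n = 0 then 0 else -(a⁻¹ ^ n)) := by
  unfold IsLogDeriv
  ext n
  rw [sub_mul, map_sub (coeff n), coeff_C_mul, coeff_mk]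
  rcases n with _ | _ | n
  · simp
  · simp [coeff_succ_X_mul, ha]
  · simp only [map_sub, derivative_X, derivative_C, coeff_succ_X_mul, coeff_mk]
    simp [coeff_one]
    field_simp
    ring

/-- The logarithmic derivative of `z ^ k - 1` is `-∑ k z ^ (k n)`, the sum starting at `n = 1`. -/
theorem X_pow_sub_one {k : ℕ} (hk : k ≠ 0) :
    IsLogDeriv (X ^ k - 1) (mk fun n => if n ≠ 0 ∧ k ∣ n then -(k : ℂ) else 0) := by
  have h := (X_sub_const one_ne_zero).expand hk
  have h1 : (X - C 1 : PowerSeries ℂ).expand k hk = X ^ k - 1 := by simp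
  rw [h1] at h
  convert h using 1
  ext n
  rw [map_nsmul, coeff_expand, coeff_mk]
  by_cases hn : k ∣ n
  · obtain ⟨d, rfl⟩ := hn
    rw [if_pos (dvd_mul_right k d), Nat.mul_div_cancel_left _ (Nat.pos_of_ne_zero hk), coeff_mk]
    by_cases hd : d = 0 <;> simp [hd, hk]
  · simp [hn]

end IsLogDeriv

/-- The coefficients of positive degree of the logarithmic derivative of the polynomial `Q` are
those of a finite product of factors `(1 - z ^ k) ^ (-D k)` for `k ≥ 1`, with `∑ D k = c`, and of
factors `1 - r z` with `r ≠ 0` not a root of unity. The finite support of `D` is expressed by the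
sums being eventually equal to `c`; coefficients of degree `0` are left out in order to ignore
factors `z`. -/
def HasLogFactorization (Q : Polynomial ℂ) (c : ℤ) : Prop :=
  ∃ (D : ℕ → ℤ) (ρ : Multiset ℂ) (H : PowerSeries ℂ),
    (∀ᶠ T in atTop, ∑ l ∈ Ioc 0 T, D l = c) ∧
    (∀ r ∈ ρ, r ≠ 0 ∧ ∀ n, n ≠ 0 → r ^ n ≠ 1) ∧
    IsLogDeriv (Q : PowerSeries ℂ) H ∧
    ∀ n, n ≠ 0 → PowerSeries.coeff n H =
      (∑ k ∈ n.divisors, k * D k : ℤ) - (ρ.map fun r => r ^ n).sum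

namespace HasLogFactorization

open Polynomial

theorem mul {P Q : ℂ[X]} {c d : ℤ} (hP : HasLogFactorization P c) (hQ : HasLogFactorization Q d) :
    HasLogFactorization (P * Q) (c + d) := by
  obtain ⟨D, ρ, H, hD, hρ, hH, hn⟩ := hP
  obtain ⟨D', ρ', H', hD', hρ', hH', hn'⟩ := hQ
  refine ⟨D + D', ρ + ρ', H + H', ?_, ?_, ?_, ?_⟩
  · filter_upwards [hD, hD'] with T h h'
    simp [sum_add_distrib, h, h']
  · intro r hr
    rcases Multiset.mem_add.1 hr with h | h
    exacts [hρ r h, hρ' r h]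
  · rw [Polynomial.coe_mul]
    exact hH.mul hH'
  · intro n h
    rw [map_add, hn n h, hn' n h, Multiset.map_add, Multiset.sum_add]
    simp only [Pi.add_apply, mul_add, sum_add_distrib]
    push_cast
    ring

theorem one : HasLogFactorization 1 0 :=
  ⟨0, 0, 0, by simp, by simp, by simpa using IsLogDeriv.one, by simp⟩

theorem const (a : ℂ) : HasLogFactorization (C a) 0 :=
  ⟨0, 0, 0, by simp, by simp, by simpa using IsLogDeriv.const a, by simp⟩

theorem X_self : HasLogFactorization X 0 :=
  ⟨0, 0, 1, by simp, by simp, by simpa using IsLogDeriv.X_self,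
    fun n hn => by simp [PowerSeries.coeff_one, hn]⟩

theorem X_sub_const {a : ℂ} (ha : a ≠ 0) (ha' : ∀ n, n ≠ 0 → a ^ n ≠ 1) :
    HasLogFactorization (X - C a) 0 := by
  refine ⟨0, {a⁻¹}, _, by simp, ?_, by simpa using IsLogDeriv.X_sub_const ha, ?_⟩
  · intro r hr
    rw [Multiset.mem_singleton.1 hr]
    exact ⟨inv_ne_zero ha, fun n hn => by simpa using ha' n hn⟩
  · intro n hn
    simp [hn]

theorem X_pow_sub_one {k : ℕ} (hk : k ≠ 0) : HasLogFactorization (X ^ k - 1) (-1) := by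
  refine ⟨fun l => if l = k then -1 else 0, 0, _, ?_, by simp,
    by simpa using IsLogDeriv.X_pow_sub_one hk, ?_⟩
  · filter_upwards [eventually_ge_atTop k] with T hT
    simp [sum_ite_eq', Nat.pos_of_ne_zero hk, hT]
  · intro n hn
    by_cases h : k ∣ n <;> simp [hn, h]

end HasLogFactorization

open Polynomial in
/-- Up to sign, the cyclotomic polynomial `Φ d` is a product of powers of factors `1 - z ^ k`.
The exponents are found by dividing `z ^ d - 1` by the `Φ k` with `k ∣ d`, `k < d`. -/
theorem exists_coeff_logDeriv_cyclotomic (d : ℕ) (hd : d ≠ 0) : ∃ D : ℕ → ℤ,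
    (∀ᶠ T in atTop, ∑ l ∈ Ioc 0 T, D l = if d = 1 then -1 else 0) ∧
    ∀ H, IsLogDeriv (cyclotomic d ℂ : PowerSeries ℂ) H →
      ∀ n, n ≠ 0 → PowerSeries.coeff n H = (∑ k ∈ n.divisors, k * D k : ℤ) := by
  induction d using Nat.strong_induction_on with
  | _ d ih =>
    have ih' : ∀ k ∈ d.properDivisors, ∃ D : ℕ → ℤ,
        (∀ᶠ T in atTop, ∑ l ∈ Ioc 0 T, D l = if k = 1 then -1 else 0) ∧
        ∀ H, IsLogDeriv (cyclotomic k ℂ : PowerSeries ℂ) H →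
          ∀ n, n ≠ 0 → PowerSeries.coeff n H = (∑ k ∈ n.divisors, k * D k : ℤ) := by
      intro k hk
      exact ih k (Nat.mem_properDivisors.1 hk).2 (Nat.pos_of_mem_properDivisors hk).ne'
    choose! E hE hE' using ih'
    refine ⟨fun l => (if l = d then -1 else 0) - ∑ k ∈ d.properDivisors, E k l, ?_, ?_⟩
    · have hall : ∀ᶠ T in atTop, ∀ k ∈ d.properDivisors,
          ∑ l ∈ Ioc 0 T, E k l = if k = 1 then -1 else 0 :=
        (Filter.eventually_all_finset _).2 hE
      filter_upwards [hall, eventually_ge_atTop d] with T hT hdT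
      rw [sum_sub_distrib, sum_comm, sum_congr rfl hT, sum_ite_eq', sum_ite_eq',
        if_pos (mem_Ioc.2 ⟨Nat.pos_of_ne_zero hd, hdT⟩)]
      by_cases h1 : d = 1
      · simp [h1]
      · rw [if_neg h1, if_pos (Nat.mem_properDivisors.2 ⟨one_dvd d, by omega⟩)]
        norm_num
    · intro H hH n hn
      have hexists : ∀ k, ∃ H, IsLogDeriv (cyclotomic k ℂ : PowerSeries ℂ) H := fun k =>
        IsLogDeriv.exists_of_ne_zero (by simpa using cyclotomic_ne_zero k ℂ)
      choose G hG using hexists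
      have hprod := (IsLogDeriv.prod d.properDivisors fun k _ => hG k).mul hH
      have heq : (∏ k ∈ d.properDivisors, (cyclotomic k ℂ : PowerSeries ℂ)) *
          (cyclotomic d ℂ : PowerSeries ℂ) = PowerSeries.X ^ d - 1 := by
        have := congrArg (coeToPowerSeries.ringHom (R := ℂ))
          (prod_cyclotomic_eq_X_pow_sub_one (Nat.pos_of_ne_zero hd) ℂ)
        rw [← Nat.cons_self_properDivisors hd, prod_cons, map_mul, map_prod, mul_comm] at this
        simpa using this
      rw [heq] at hprod
      have hX0 : (PowerSeries.X ^ d - 1 : PowerSeries ℂ) ≠ 0 := fun h => by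
        have := congrArg PowerSeries.constantCoeff h
        simp [hd] at this
      have := congrArg (PowerSeries.coeff n)
        (hprod.unique hX0 (IsLogDeriv.X_pow_sub_one hd))
      rw [map_add, map_sum, sum_congr rfl fun k hk => hE' k hk _ (hG k) n hn,
        PowerSeries.coeff_mk] at this
      rw [eq_sub_of_add_eq' this]
      simp only [mul_sub, sum_sub_distrib, mul_sum]
      rw [sum_comm]
      push_cast
      by_cases h : d ∣ n <;> simp [hn, h]

open Polynomial in
theorem hasLogFactorization_cyclotomic {d : ℕ} (hd : d ≠ 0) (hd1 : d ≠ 1) :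
    HasLogFactorization (cyclotomic d ℂ) 0 := by
  obtain ⟨D, hD, hn⟩ := exists_coeff_logDeriv_cyclotomic d hd
  obtain ⟨H, hH⟩ := IsLogDeriv.exists_of_ne_zero
    (G := (cyclotomic d ℂ : PowerSeries ℂ)) (by simpa using cyclotomic_ne_zero d ℂ)
  exact ⟨D, 0, H, by simpa [hd1] using hD, by simp, hH, fun n h => by simpa using hn H hH n h⟩

open Polynomial in
/-- The roots of unity among the roots of a rational polynomial come in full sets of primitive
`d`-th roots, which are split off as cyclotomic factors. -/
theorem hasLogFactorization_map (Q : ℚ[X]) (hQ : Q.eval 1 ≠ 0) :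
    HasLogFactorization (Q.map (algebraMap ℚ ℂ)) 0 := by
  induction hdeg : Q.natDegree using Nat.strong_induction_on generalizing Q with
  | _ N ih =>
    have hQ0 : Q ≠ 0 := by
      rintro rfl
      simp at hQ
    by_cases hroot : ∃ z : ℂ, aeval z Q = 0 ∧ ∃ n, n ≠ 0 ∧ z ^ n = 1
    · obtain ⟨z, hz, n, hn, hzn⟩ := hroot
      have hfin : orderOf z ≠ 0 :=
        (orderOf_pos_iff.2 (isOfFinOrder_iff_pow_eq_one.2 ⟨n, Nat.pos_of_ne_zero hn, hzn⟩)).ne'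
      have hz1 : orderOf z ≠ 1 := by
        intro h
        rw [orderOf_eq_one_iff.1 h, ← map_one (algebraMap ℚ ℂ), aeval_algebraMap_apply] at hz
        simp only [coe_aeval_eq_eval, map_eq_zero] at hz
        exact hQ hz
      obtain ⟨R, rfl⟩ : cyclotomic (orderOf z) ℚ ∣ Q := by
        rw [cyclotomic_eq_minpoly_rat (IsPrimitiveRoot.orderOf z) (Nat.pos_of_ne_zero hfin)]
        exact minpoly.dvd ℚ z hz
      have hR0 : R ≠ 0 := right_ne_zero_of_mul hQ0
      have hlt : R.natDegree < N := by
        rw [← hdeg, natDegree_mul (cyclotomic_ne_zero _ ℚ) hR0, natDegree_cyclotomic]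
        have := Nat.totient_pos.2 (Nat.pos_of_ne_zero hfin)
        omega
      rw [Polynomial.map_mul, map_cyclotomic, ← add_zero (0 : ℤ)]
      refine (hasLogFactorization_cyclotomic hfin hz1).mul (ih _ hlt R ?_ rfl)
      rw [eval_mul] at hQ
      exact right_ne_zero_of_mul hQ
    · push Not at hroot
      rw [(IsAlgClosed.splits (Q.map (algebraMap ℚ ℂ))).eq_prod_roots, ← add_zero (0 : ℤ)]
      refine (HasLogFactorization.const _).mul ?_
      have hr : ∀ r ∈ (Q.map (algebraMap ℚ ℂ)).roots, HasLogFactorization (X - C r) 0 := by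
        intro r hr
        by_cases hr0 : r = 0
        · rw [hr0, map_zero, sub_zero]
          exact HasLogFactorization.X_self
        · refine HasLogFactorization.X_sub_const hr0 (hroot r ?_)
          rw [mem_roots_map hQ0] at hr
          exact hr
      revert hr
      generalize (Q.map (algebraMap ℚ ℂ)).roots = s
      induction s using Multiset.induction_on with
      | empty => exact fun _ => by simpa using HasLogFactorization.one
      | cons r s ihs =>
        intro hr
        rw [Multiset.map_cons, Multiset.prod_cons, ← add_zero (0 : ℤ)]
        exact (hr r (Multiset.mem_cons_self r s)).mul
          (ihs fun r' h => hr r' (Multiset.mem_cons_of_mem h))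

/-! ### Mean values and Möbius inversion -/

/-- A mean value on complex sequences: it is `1` on the constant sequence `1` and vanishes on all
other exponential sequences, which are linearly independent of it by Dedekind's theorem. -/
theorem exists_mean : ∃ Λ : (ℕ → ℂ) →ₗ[ℚ] ℚ, Λ (fun _ => 1) = 1 ∧
    ∀ c β : ℂ, β ≠ 1 → Λ (fun y => c * β ^ y) = 0 := by
  have hli := linearIndependent_monoidHom (Multiplicative ℕ) ℂ
  have hnot := hli.notMem_span_image (s := {1}ᶜ) (x := 1) (by simp)
  obtain ⟨f, hf1, hf⟩ := Submodule.exists_le_ker_of_notMem hnot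
  obtain ⟨φ, hφ1, -⟩ := Submodule.exists_le_ker_of_notMem (K := ℚ) (V := ℂ) (p := ⊥)
    (v := f fun _ => 1) (by
      rw [Submodule.mem_bot]
      exact hf1)
  let g : (ℕ → ℂ) →ₗ[ℂ] ℂ := f
  refine ⟨(φ (f fun _ => 1))⁻¹ • φ ∘ₗ (g.restrictScalars ℚ), ?_, fun c β hβ => ?_⟩
  · exact inv_mul_cancel₀ hφ1
  · have hmem : (powersHom ℂ β : Multiplicative ℕ → ℂ) ∈ LinearMap.ker f := by
      refine hf (Submodule.subset_span ⟨powersHom ℂ β, ?_, rfl⟩)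
      intro h
      apply hβ
      simpa using DFunLike.congr_fun h (Multiplicative.ofAdd 1)
    have h0 : g (fun y => β ^ y) = 0 := hmem
    have h1 : g (fun y => c * β ^ y) = 0 := by
      have := g.map_smul c (fun y => β ^ y)
      rw [h0, smul_zero] at this
      exact this
    simp [h1]

theorem sum_divisors_eq_sum_Ioc {D : ℕ → ℤ} {S : ℕ} (hS : ∀ l, S < l → D l = 0) {n : ℕ}
    (hn : n ≠ 0) :
    ∑ k ∈ n.divisors, k * D k = ∑ k ∈ Ioc 0 S, if k ∣ n then k * D k else 0 := by
  rw [← sum_filter]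
  symm
  refine sum_subset (fun k hk => ?_) fun k hk hk' => ?_
  · rw [mem_filter] at hk
    exact Nat.mem_divisors.2 ⟨hk.2, hn⟩
  · have h1 := Nat.pos_of_mem_divisors hk
    have h2 := Nat.dvd_of_mem_divisors hk
    simp only [mem_filter, mem_Ioc, h1, h2, true_and, and_true, not_le] at hk'
    rw [hS k hk', mul_zero]

/-- Along `n * (1 + K * y)`, with `K` divisible by all relevant moduli, the divisibility conditions
do not depend on `y`, and the `ρ` contribute exponential sequences in `y` different from the
constant one. Taking mean values in `y` removes the `ρ`. -/
theorem exists_dilation_sum_eq {m : ℕ} {b e : Fin (m + 1) → ℕ} (hpos : ∀ i, 0 < b i)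
    {D : ℕ → ℤ} {S : ℕ} (hS : ∀ l, S < l → D l = 0) {ρ : Multiset ℂ}
    (hρ : ∀ r ∈ ρ, r ≠ 0 ∧ ∀ n, n ≠ 0 → r ^ n ≠ 1) {a : ℕ → ℂ}
    (ha : ∀ n, n ≠ 0 → ∑ i, (if b i ∣ n then ((e i * b i : ℕ) : ℂ) * a (n / b i) else 0) =
      (∑ k ∈ n.divisors, k * D k : ℤ) - (ρ.map fun r => r ^ n).sum) :
    ∃ M : ℕ → ℚ, ∀ n, n ≠ 0 →
      ∑ i, (if b i ∣ n then ((e i * b i : ℕ) : ℚ) * M (n / b i) else 0) =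
        (∑ k ∈ n.divisors, k * D k : ℤ) := by
  obtain ⟨Λ, hΛ1, hΛ⟩ := exists_mean
  set K := (∏ i, b i) * S.factorial with hK
  have hK0 : K ≠ 0 := Nat.mul_ne_zero (prod_ne_zero_iff.2 fun i _ => (hpos i).ne')
    (Nat.factorial_ne_zero S)
  have hdvd : ∀ k, k ∣ K → ∀ n y, k ∣ n * (1 + K * y) ↔ k ∣ n := by
    intro k hk n y
    refine Nat.Coprime.dvd_mul_right ?_
    obtain ⟨c, hc⟩ := hk
    rw [hc, mul_assoc]
    simp
  have hb : ∀ i, b i ∣ K := fun i => (dvd_prod_of_mem b (mem_univ i)).mul_right _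
  refine ⟨fun n => Λ fun y => a (n * (1 + K * y)), fun n hn => ?_⟩
  have hfun : (fun y => ∑ i, (if b i ∣ n then ((e i * b i : ℕ) : ℂ) * a (n / b i * (1 + K * y))
      else 0)) = fun y => ((∑ k ∈ n.divisors, k * D k : ℤ) : ℂ) * 1 -
        (ρ.map fun r => r ^ n * (r ^ (n * K)) ^ y).sum := by
    funext y
    have hny : n * (1 + K * y) ≠ 0 := Nat.mul_ne_zero hn (by omega)
    have h := ha _ hny
    rw [sum_divisors_eq_sum_Ioc hS hny] at h
    rw [sum_divisors_eq_sum_Ioc hS hn, mul_one]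
    convert h using 1
    · refine sum_congr rfl fun i _ => ?_
      by_cases hi : b i ∣ n
      · rw [if_pos hi, if_pos ((hdvd _ (hb i) n y).2 hi), Nat.div_mul_right_comm hi]
      · rw [if_neg hi, if_neg (mt (hdvd _ (hb i) n y).1 hi)]
    · refine congrArg₂ (· - ·) (congrArg Int.cast (sum_congr rfl fun k hk => ?_))
        (congrArg Multiset.sum (Multiset.map_congr rfl fun r _ => ?_))
      · have hkS : k ∣ K :=
          (Nat.dvd_factorial (mem_Ioc.1 hk).1 (mem_Ioc.1 hk).2).mul_left _
        simp only [hdvd k hkS n y]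
      · rw [← pow_mul, ← pow_add]
        ring_nf
  have hρ0 : Λ (fun y => (ρ.map fun r => r ^ n * (r ^ (n * K)) ^ y).sum) = 0 := by
    have hne : ∀ r ∈ ρ, r ^ (n * K) ≠ 1 := fun r hr => (hρ r hr).2 _ (Nat.mul_ne_zero hn hK0)
    clear ha hρ hfun
    induction ρ using Multiset.induction_on with
    | empty =>
      simp only [Multiset.map_zero, Multiset.sum_zero]
      exact Λ.map_zero
    | cons r s ih =>
      simp only [Multiset.map_cons, Multiset.sum_cons]
      have := Λ.map_add (fun y => r ^ n * (r ^ (n * K)) ^ y)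
        (fun y => (s.map fun r => r ^ n * (r ^ (n * K)) ^ y).sum)
      rw [hΛ _ _ (hne r (Multiset.mem_cons_self r s)),
        ih fun r' h => hne r' (Multiset.mem_cons_of_mem h), add_zero] at this
      exact this
  have hleft : Λ (fun y => ∑ i, (if b i ∣ n then
      ((e i * b i : ℕ) : ℂ) * a (n / b i * (1 + K * y)) else 0)) =
      ∑ i, (if b i ∣ n then ((e i * b i : ℕ) : ℚ) * Λ fun y => a (n / b i * (1 + K * y))
        else 0) := by
    have : (fun y => ∑ i, (if b i ∣ n then
        ((e i * b i : ℕ) : ℂ) * a (n / b i * (1 + K * y)) else 0)) =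
        ∑ i, (if b i ∣ n then
          ((e i * b i : ℕ) : ℚ) • (fun y => a (n / b i * (1 + K * y))) else 0) := by
      funext y
      rw [Finset.sum_apply]
      refine sum_congr rfl fun i _ => ?_
      split_ifs
      · simp [Algebra.smul_def]
      · rfl
    rw [this, map_sum]
    refine sum_congr rfl fun i _ => ?_
    split_ifs
    · rw [map_smul, smul_eq_mul]
    · exact map_zero Λ
  have hright : Λ (fun y => ((∑ k ∈ n.divisors, k * D k : ℤ) : ℂ) * 1 -
      (ρ.map fun r => r ^ n * (r ^ (n * K)) ^ y).sum) = (∑ k ∈ n.divisors, k * D k : ℤ) := by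
    have h1 := Λ.map_sub (fun _ => ((∑ k ∈ n.divisors, k * D k : ℤ) : ℂ) * 1)
      (fun y => (ρ.map fun r => r ^ n * (r ^ (n * K)) ^ y).sum)
    have h2 := Λ.map_smul ((∑ k ∈ n.divisors, k * D k : ℤ) : ℚ) (fun _ => (1 : ℂ))
    rw [hΛ1, smul_eq_mul, mul_one] at h2
    rw [hρ0, sub_zero] at h1
    refine h1.trans (Eq.trans (congrArg Λ ?_) h2)
    funext y
    simp [Algebra.smul_def]
  rw [← hleft, hfun, hright]

theorem sum_divisors_dvd {R : Type*} [AddCommMonoid R] (f : ℕ → R) {b n : ℕ} (hb : 0 < b)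
    (hn : n ≠ 0) :
    ∑ l ∈ n.divisors, (if b ∣ l then f (l / b) else 0) =
      if b ∣ n then ∑ x ∈ (n / b).divisors, f x else 0 := by
  split_ifs with hbn
  · obtain ⟨k, rfl⟩ := hbn
    have hk : k ≠ 0 := right_ne_zero_of_mul hn
    rw [← sum_filter, Nat.mul_div_cancel_left _ hb]
    refine sum_nbij' (fun l => l / b) (fun x => b * x) ?_ ?_ ?_ ?_ ?_
    · intro l hl
      simp only [mem_filter, Nat.mem_divisors] at hl ⊢
      obtain ⟨c, rfl⟩ := hl.2
      rw [Nat.mul_div_cancel_left _ hb]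
      exact ⟨Nat.dvd_of_mul_dvd_mul_left hb hl.1.1, hk⟩
    · intro x hx
      simp only [mem_filter, Nat.mem_divisors] at hx ⊢
      exact ⟨⟨mul_dvd_mul_left b hx.1, hn⟩, dvd_mul_right _ _⟩
    · intro l hl
      exact Nat.mul_div_cancel' (mem_filter.1 hl).2
    · intro x _
      exact Nat.mul_div_cancel_left x hb
    · intro l _
      rfl
  · refine sum_eq_zero fun l hl => if_neg fun h => hbn (h.trans (Nat.dvd_of_mem_divisors hl))

/-- Möbius inversion of the relation between mean values. -/
theorem exists_dilation_solution {m : ℕ} {b e : Fin (m + 1) → ℕ} (hpos : ∀ i, 0 < b i)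
    {D : ℕ → ℤ} {M : ℕ → ℚ} (hM : ∀ n, n ≠ 0 →
      ∑ i, (if b i ∣ n then ((e i * b i : ℕ) : ℚ) * M (n / b i) else 0) =
        (∑ k ∈ n.divisors, k * D k : ℤ)) :
    ∃ α : ℕ → ℚ, ∀ l, l ≠ 0 →
      ∑ i, (if b i ∣ l then (e i : ℚ) * α (l / b i) else 0) = D l := by
  obtain ⟨f, hf⟩ : ∃ f : ℕ → ℚ, ∀ n > 0, ∑ k ∈ n.divisors, f k = M n :=
    ⟨_, ArithmeticFunction.sum_eq_iff_sum_mul_moebius_eq.2 fun n _ => rfl⟩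
  have h1 : ∀ n > 0, ∑ l ∈ n.divisors,
      (∑ i, if b i ∣ l then ((e i * b i : ℕ) : ℚ) * f (l / b i) else 0) =
        (∑ k ∈ n.divisors, k * D k : ℤ) := by
    intro n hn
    rw [← hM n hn.ne', sum_comm]
    refine sum_congr rfl fun i _ => ?_
    rw [sum_divisors_dvd (fun x => ((e i * b i : ℕ) : ℚ) * f x) (hpos i) hn.ne']
    split_ifs with h
    · rw [← mul_sum, hf _ (Nat.div_pos (Nat.le_of_dvd hn h) (hpos i))]
    · rfl
  have h2 : ∀ n > 0, ∑ l ∈ n.divisors, (l * D l : ℚ) = (∑ k ∈ n.divisors, k * D k : ℤ) := by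
    intro n _
    push_cast
    rfl
  rw [ArithmeticFunction.sum_eq_iff_sum_mul_moebius_eq] at h1 h2
  refine ⟨fun k => f k / k, fun l hl => ?_⟩
  have hl' : (l : ℚ) ≠ 0 := by exact_mod_cast hl
  have h3 := (h1 l (Nat.pos_of_ne_zero hl)).symm.trans (h2 l (Nat.pos_of_ne_zero hl))
  apply mul_left_cancel₀ hl'
  rw [← h3, mul_sum]
  refine sum_congr rfl fun i _ => ?_
  split_ifs with h
  · obtain ⟨k, rfl⟩ := h
    have hk : (k : ℚ) ≠ 0 := by exact_mod_cast right_ne_zero_of_mul hl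
    rw [Nat.mul_div_cancel_left _ (hpos i)]
    push_cast
    field_simp
  · simp

/-! ### The generating series of the representation function -/

open Classical in
/-- The generating series `∑ z ^ a` over `a ∈ A`. -/
noncomputable def genSeries (A : Set ℕ) : PowerSeries ℂ :=
  PowerSeries.mk fun n => if n ∈ A then 1 else 0

theorem coeff_prod_genSeries {m : ℕ} {b : Fin (m + 1) → ℕ} (hb : ∀ i, b i ≠ 0)
    (e : Fin (m + 1) → ℕ) (A : Set ℕ) (n : ℕ) :
    PowerSeries.coeff n (∏ i, ((genSeries A).expand (b i) (hb i)) ^ e i) = repFun b e A n := by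
  classical
  have h1 : ∏ i, ((genSeries A).expand (b i) (hb i)) ^ e i =
      ∏ s : (i : Fin (m + 1)) × Fin (e i), (genSeries A).expand (b s.1) (hb s.1) := by
    rw [Fintype.prod_sigma]
    exact prod_congr rfl fun i _ => (Fin.prod_const (e i) _).symm
  have h2 : ∀ l : ((i : Fin (m + 1)) × Fin (e i)) →₀ ℕ,
      ∏ s, PowerSeries.coeff (l s) ((genSeries A).expand (b s.1) (hb s.1)) =
        if ∀ s, ∃ a ∈ A, b s.1 * a = l s then (1 : ℂ) else 0 := by
    intro l
    rw [← Fintype.prod_boole]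
    refine prod_congr rfl fun s _ => ?_
    rw [PowerSeries.coeff_expand, genSeries, PowerSeries.coeff_mk, ← ite_and]
    refine if_congr ⟨fun h => ⟨_, h.2, Nat.mul_div_cancel' h.1⟩, ?_⟩ rfl rfl
    rintro ⟨a, ha, h⟩
    rw [← h, Nat.mul_div_cancel_left _ (Nat.pos_of_ne_zero (hb _))]
    exact ⟨dvd_mul_right _ _, ha⟩
  rw [h1, PowerSeries.coeff_prod, sum_congr rfl fun l _ => h2 l, sum_boole, repFun,
    ← Set.ncard_coe_finset]
  let Φ : ((i : Fin (m + 1)) → Fin (e i) → ℕ) → (((i : Fin (m + 1)) × Fin (e i)) →₀ ℕ) :=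
    fun a => Finsupp.equivFunOnFinite.symm fun s => b s.1 * a s.1 s.2
  have hΦ : Function.Injective Φ := by
    intro a a' h
    funext i j
    have := DFunLike.congr_fun h ⟨i, j⟩
    exact Nat.eq_of_mul_eq_mul_left (Nat.pos_of_ne_zero (hb i)) this
  rw [← Set.ncard_image_of_injective (repSet b e A n) hΦ]
  congr 2
  ext l
  simp only [coe_filter, mem_finsuppAntidiag, Set.mem_ofPred_eq, Set.mem_image, repSet]
  constructor
  · rintro ⟨⟨hl, -⟩, h⟩
    choose a ha hal using h
    refine ⟨fun i j => a ⟨i, j⟩, ⟨fun i j => ha _, ?_⟩, ?_⟩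
    · rw [← hl, Fintype.sum_sigma]
      refine sum_congr rfl fun i _ => ?_
      rw [mul_sum]
      exact sum_congr rfl fun j _ => (hal ⟨i, j⟩).symm
    · ext s
      exact hal s
  · rintro ⟨a, ⟨ha, hn⟩, rfl⟩
    refine ⟨⟨?_, subset_univ _⟩, fun s => ⟨a s.1 s.2, ha _ _, rfl⟩⟩
    rw [hn, Fintype.sum_sigma]
    refine sum_congr rfl fun i _ => ?_
    rw [mul_sum]
    rfl

/-- The solution with all variables equal shows that infinitely many values are positive. -/
theorem exists_le_repFun_ne_zero {m : ℕ} {b e : Fin (m + 1) → ℕ} (hpos : ∀ i, 0 < b i)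
    (he : ∀ i, 0 < e i) {A : Set ℕ} (hA : A.Infinite) (n₀ : ℕ) :
    ∃ n, n₀ ≤ n ∧ repFun b e A n ≠ 0 := by
  obtain ⟨a, ha, han⟩ := hA.exists_gt n₀
  refine ⟨∑ i, b i * ∑ _j : Fin (e i), a, ?_, ?_⟩
  · have h1 : b 0 * ∑ _j : Fin (e 0), a ≤ ∑ i, b i * ∑ _j : Fin (e i), a :=
      single_le_sum (f := fun i => b i * ∑ _j : Fin (e i), a) (fun _ _ => Nat.zero_le _)
        (mem_univ 0)
    have h2 : a ≤ b 0 * ∑ _j : Fin (e 0), a := by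
      simp only [sum_const, card_univ, Fintype.card_fin, smul_eq_mul]
      exact (Nat.le_mul_of_pos_left a (he 0)).trans (Nat.le_mul_of_pos_left _ (hpos 0))
    omega
  · exact ((Set.ncard_pos (repSet_finite b e hpos A _)).2 ⟨fun _ _ => a, fun _ _ => ha, rfl⟩).ne'

open Polynomial in
theorem exists_polynomial_of_eventually_const {r : ℕ → ℕ} {c n₀ : ℕ}
    (hr : ∀ n, n₀ ≤ n → r n = c) : ∃ Q : ℚ[X], Q.eval 1 = -c ∧
      PowerSeries.mk (fun n => (r n : ℂ)) * (PowerSeries.X ^ 1 - 1) =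
        (Q.map (algebraMap ℚ ℂ) : PowerSeries ℂ) := by
  refine ⟨(∑ n ∈ range n₀, C (r n : ℚ) * X ^ n) * (X - 1) - C (c : ℚ) * X ^ n₀, by simp, ?_⟩
  have h : PowerSeries.mk (fun n => (r n : ℂ)) =
      ∑ n ∈ range n₀, PowerSeries.C (r n : ℂ) * PowerSeries.X ^ n +
        PowerSeries.C (c : ℂ) * PowerSeries.X ^ n₀ * PowerSeries.mk 1 := by
    ext n
    rw [map_add, map_sum, mul_assoc, PowerSeries.coeff_C_mul, PowerSeries.coeff_X_pow_mul',
      PowerSeries.coeff_mk]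
    simp only [PowerSeries.coeff_C_mul, PowerSeries.coeff_X_pow]
    by_cases hn : n₀ ≤ n
    · simp [hn, hr n hn]
    · simp [hn, not_le.1 hn]
  have h1 := PowerSeries.mk_one_mul_one_sub_eq_one ℂ
  have hC : ∀ k : ℕ, algebraMap ℚ ℂ (k : ℚ) = k := fun k => map_natCast _ k
  rw [h]
  simp only [Polynomial.map_sub, Polynomial.map_mul, Polynomial.map_sum, Polynomial.map_pow,
    map_C, map_X, Polynomial.map_one, hC]
  have hcoe := map_sum (coeToPowerSeries.ringHom (R := ℂ))
    (fun n => C (r n : ℂ) * X ^ n) (range n₀)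
  simp only [coeToPowerSeries.ringHom_apply, Polynomial.coe_mul, Polynomial.coe_pow,
    Polynomial.coe_C, Polynomial.coe_X] at hcoe
  have hsub : ∀ P R : ℂ[X], ((P - R : ℂ[X]) : PowerSeries ℂ) = P - R := fun P R =>
    map_sub (coeToPowerSeries.ringHom (R := ℂ)) P R
  simp only [hsub, Polynomial.coe_mul, Polynomial.coe_pow, Polynomial.coe_C, Polynomial.coe_X,
    Polynomial.coe_one, hcoe, pow_one]
  linear_combination (-PowerSeries.C (c : ℂ) * PowerSeries.X ^ n₀) * h1

theorem theorem1 (m : ℕ) (hm : 1 ≤ m) (b e : Fin (m + 1) → ℕ)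
    (hb0 : 0 < b 0) (hb : StrictMono b) (he : ∀ i, 0 < e i)
    (hp : ∃ p t : ℕ, p.Prime ∧ 0 < t ∧ p ^ t ∣ b 0 ∧ ∀ i, i ≠ 0 → ¬ p ^ t ∣ b i)
    (A : Set ℕ) (hA : A.Infinite) :
    ¬ ∃ c n₀ : ℕ, ∀ n, n₀ ≤ n → repFun b e A n = c := by
  rintro ⟨c, n₀, hc⟩
  obtain ⟨p, t, hp, -, hpt, hpt'⟩ := hp
  have hpos : ∀ i, 0 < b i := fun i => hb0.trans_le (hb.monotone (Fin.zero_le i))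
  have hc0 : c ≠ 0 := by
    obtain ⟨n, hn, h⟩ := exists_le_repFun_ne_zero hpos he hA n₀
    rwa [hc n hn] at h
  obtain ⟨Q, hQ1, hQ⟩ := exists_polynomial_of_eventually_const hc
  obtain ⟨D, ρ, H, hD, hρ, hH, hHn⟩ := hasLogFactorization_map Q (by simpa [hQ1] using hc0)
  have hprod : PowerSeries.mk (fun n => (repFun b e A n : ℂ)) =
      ∏ i, ((genSeries A).expand (b i) (hpos i).ne') ^ e i := by
    ext n
    rw [PowerSeries.coeff_mk, coeff_prod_genSeries]
  have hA0 : genSeries A ≠ 0 := by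
    obtain ⟨a, ha⟩ := hA.nonempty
    intro h
    have := congrArg (PowerSeries.coeff a) h
    simp [genSeries, ha] at this
  obtain ⟨G, hG⟩ := IsLogDeriv.exists_of_ne_zero hA0
  have hlog := (IsLogDeriv.prod univ fun i _ => (hG.expand (hpos i).ne').pow (e i)).mul
    (IsLogDeriv.X_pow_sub_one one_ne_zero)
  rw [← hprod, hQ] at hlog
  have hQ0 : (Q.map (algebraMap ℚ ℂ) : PowerSeries ℂ) ≠ 0 := by
    have : Q ≠ 0 := by
      rintro rfl
      simp [hc0] at hQ1
    simpa [Polynomial.map_eq_zero] using this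
  have heq := hlog.unique hQ0 hH
  -- the factor `z - 1` is moved to the other side, where it contributes to the exponent `D 1`
  set D' : ℕ → ℤ := fun k => D k + if k = 1 then 1 else 0 with hD'
  have hD'1 : ∀ᶠ T in atTop, ∑ l ∈ Ioc 0 T, D' l = 1 := by
    filter_upwards [hD, eventually_ge_atTop 1] with T hT h1
    simp [hD', sum_add_distrib, hT, h1]
  obtain ⟨S, hS⟩ := exists_forall_lt_of_eventually_sum hD'1
  obtain ⟨M, hM⟩ := exists_dilation_sum_eq (e := e) hpos hS hρ (a := fun n => PowerSeries.coeff n G)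
    fun n hn => by
      have h := congrArg (PowerSeries.coeff n) heq
      rw [hHn n hn, map_add, map_sum, PowerSeries.coeff_mk, if_pos ⟨hn, one_dvd n⟩] at h
      have h' : (∑ k ∈ n.divisors, k * D' k : ℤ) = ∑ k ∈ n.divisors, k * D k + 1 := by
        simp [hD', mul_add, sum_add_distrib, hn]
      rw [h', Int.cast_add, Int.cast_one, add_sub_right_comm, ← h]
      simp only [Nat.cast_one, neg_add_cancel_right]
      refine sum_congr rfl fun i _ => ?_
      rw [← mul_smul, map_nsmul, PowerSeries.coeff_expand]
      split_ifs <;> simp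
  obtain ⟨α, hα⟩ := exists_dilation_solution hpos hM
  exact no_dilation_solution hm hb0 hb he hp hpt hpt' hD'1 hα
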